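/- Consider an anonymous asynchronous ring of $n\ge 1$ nodes, in which each node communicates with its two neighbours through two ports, Port $0$ and Port $1$, assigned to the two neighbours in an arbitrary way that need not be consistent around the ring. Messages carry no content (pulses); they are neither lost nor created by the channels, and a scheduler decides arbitrarily in which order the pulses in transit are received. Each node has its own independent source of randomness, does not know $n$, and acts once at the start and then only upon receiving a pulse. The network is in quiescence when no pulse is in transit. Let $c>0$ be a constant and $p=2^{-1/(c+2)}$. First, without communication, every node $v$ samples $B_v\in\{1,2,\dots\}$ from the geometric distribution with parameter $1-p$, i.e. $\Pr[B_v=k]=p^{k-1}(1-p)$, and then samples $\mathrm{ID}_v$ uniformly from $\{0,1\}^{B_v}$, where the bit strings of length $k$ are identified with the integers $1,\dots,2^{k}$ (one plus the binary value). Then every node $v$ runs the following algorithm, where $\rho_i$ denotes the number of pulses $v$ has received so far at Port $i$. At the start, $v$ sets $\mathrm{ID}_v^{(i)}:=2\,\mathrm{ID}_v-1+i$ for $i\in\{0,1\}$ (or, in the message-saving variant, $\mathrm{ID}_v^{(i)}:=\mathrm{ID}_v+i$), and sends one pulse through each of its ports. Whenever $v$ receives a pulse at Port $1-i$, with $\rho_{1-i}$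 already counting this pulse: 1. it sends a pulse through Port $i$ unless $\rho_{1-i}=\mathrm{ID}_v^{(i)}$; 2. if $\max(\rho_0,\rho_1)\ge \mathrm{ID}_v^{(1)}$, it sets its state to Leader if $\rho_0=\mathrm{ID}_v^{(1)}$ and $\rho_1<\mathrm{ID}_v^{(1)}$, and to Non-Leader otherwise, and it names Port $1$ its clockwise port if $\rho_0>\rho_1$, and Port $0$ otherwise; 3. if $\min(\rho_0,\rho_1)>\mathrm{ID}_v$, it replaces $\mathrm{ID}_v$ by a fresh sample, uniform in $\{1,\dots,\min(\rho_0,\rho_1)-1\}$ (the values $\mathrm{ID}_v^{(0)},\mathrm{ID}_v^{(1)}$ are not changed). Then, with high probability, all nodes hold distinct IDs when the network reaches quiescence. Precisely: there is a universal constant $\kappa>0$ such that for every constant $c>0$ there is an $n_0$ such that for all $n\ge n_0$, for each of the two choices of $\mathrm{ID}_v^{(i)}$ and every assignment of the ports, with probability at least $1-n^{-\kappa c}$ the following holds: under every scheduler, the network reaches quiescence, and at that time the IDs $\mathrm{ID}_v$ are pairwise distinct. -/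

import Mathlib

namespace AnonRing

open MeasureTheory ProbabilityTheory

/-! ### Sampling the initial IDs (no communication) -/

/-- The parameter `1 - p` of the geometric distribution, where `p = 2 ^ (-1 / (c + 2))`. -/
noncomputable def geoParam (c : ℝ) (hc : 0 < c) : unitInterval :=
  ⟨1 - (2 : ℝ) ^ (-1 / (c + 2)), by
    have h0 : (0 : ℝ) ≤ (2 : ℝ) ^ (-1 / (c + 2)) := by positivity
    have h1 : (2 : ℝ) ^ (-1 / (c + 2)) ≤ 1 :=
      Real.rpow_le_one_of_one_le_of_nonpos (by norm_num)
        (div_nonpos_of_nonpos_of_nonneg (by norm_num) (by linarith))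
    exact ⟨by linarith, by linarith⟩⟩

/-- A bit string of length `k`, read as a positive integer: one plus its binary value. This
identifies `{0,1}^k` with `{1, ..., 2^k}` (IDs are positive integers). -/
def bitsToId {k : ℕ} (b : Fin k → Bool) : ℕ :=
  1 + ∑ i : Fin k, (b i).toNat * 2 ^ (i : ℕ)

/-- The law of a sampled ID: `BitCount` is geometric with parameter `1 - p` on `{1, 2, ...}`, then
the ID is uniform over the bit strings of length `BitCount`. Mathlib's geometric law counts the
failures before the first success, so it is the law of `BitCount - 1`. -/
noncomputable def sampledId (c : ℝ) (hc : 0 < c) : PMF ℕ :=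
  (geometricMeasure (geoParam c hc)).toPMF.bind fun k =>
    (PMF.uniformOfFintype (Fin (k + 1) → Bool)).map bitsToId

/-! ### The nodes' sources of randomness -/

/-- The uniform law on `{1, ..., m}` for `m ≥ 1` (for `m = 0`, which is never used, on `{1}`). -/
noncomputable def uniformUpTo (m : ℕ) : PMF ℕ :=
  PMF.uniformOfFinset (Finset.Icc 1 (max 1 m)) ⟨1, by simp⟩

/-- The randomness of one node: its initially sampled ID, and its coins. The coin `(j, m)` is the
value that the node draws if it samples uniformly from `{1, ..., m}` upon receiving its `j`-th
pulse. -/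
abbrev NodeSource : Type := ℕ × (ℕ × ℕ → ℕ)

/-- The law of one node's randomness: the initial ID and all the coins are independent. -/
noncomputable def nodeSourceLaw (c : ℝ) (hc : 0 < c) : Measure NodeSource :=
  (sampledId c hc).toMeasure.prod
    (Measure.infinitePi fun i : ℕ × ℕ => (uniformUpTo i.2).toMeasure)

/-- The randomness of all the nodes of a ring of size `n`; distinct nodes are independent. -/
noncomputable def networkLaw (c : ℝ) (hc : 0 < c) (n : ℕ) [NeZero n] :
    Measure (ZMod n → NodeSource) :=
  Measure.pi fun _ => nodeSourceLaw c hc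

/-! ### The algorithm of a node

Ports are Booleans: `false` is Port 0 and `true` is Port 1. -/

/-- The two ways to choose the virtual IDs of a node: `ID⁽ⁱ⁾ = 2 * ID - 1 + i`, or the
message-saving variant `ID⁽ⁱ⁾ = ID + i`. -/
inductive VirtualIdRule
  | doubling
  | successor

/-- The virtual ID `ID⁽ⁱ⁾`, as a function of the ID (which is at least `1`). -/
def VirtualIdRule.virtualId : VirtualIdRule → ℕ → Bool → ℕ
  | doubling, x, i => 2 * x - 1 + i.toNat
  | successor, x, i => x + i.toNat

/-- The local variables of a node: its current ID, its two virtual IDs, the numbers of pulses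
received so far at the two ports, its output (`some true` is Leader, `some false` is Non-Leader),
and the port it names clockwise. -/
structure NodeState where
  id : ℕ
  virt : Bool → ℕ
  recv : Bool → ℕ
  leader : Option Bool
  cwPort : Option Bool

/-- The state of a node after its initialization. The virtual IDs are fixed here once and for
all. -/
def NodeState.init (rule : VirtualIdRule) (src : NodeSource) : NodeState where
  id := src.1
  virt := rule.virtualId src.1
  recv := fun _ => 0
  leader := none
  cwPort := none

/-- Count a pulse received at port `p`. -/
def NodeState.count (s : NodeState) (p : Bool) : NodeState :=
  { s with recv := Function.update s.recv p (s.recv p + 1) }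

/-- Whether the pulse just received (and counted) at port `p = 1 - i` is forwarded through the
opposite port `i`: it is unless the count equals `ID⁽ⁱ⁾`. -/
def NodeState.forwards (s : NodeState) (p : Bool) : Prop :=
  s.recv p ≠ s.virt (!p)

instance (s : NodeState) (p : Bool) : Decidable (s.forwards p) :=
  inferInstanceAs (Decidable (_ ≠ _))

/-- Recompute the output of the node. -/
def NodeState.computeOutput (s : NodeState) : NodeState :=
  if s.virt true ≤ max (s.recv false) (s.recv true) then
    { s with
      leader := some (decide (s.recv false = s.virt true ∧ s.recv true < s.virt true))
      cwPort := some (decide (s.recv true < s.recv false)) }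
  else s

/-- The modification: if the smaller of the two counts, `m`, exceeds the ID, then the ID is
replaced by a fresh uniform sample from `{1, ..., m - 1}`. -/
def NodeState.resample (coin : ℕ × ℕ → ℕ) (s : NodeState) : NodeState :=
  let m := min (s.recv false) (s.recv true)
  if s.id < m then { s with id := coin (s.recv false + s.recv true, m - 1) } else s

/-! ### The ring and its executions -/

/-- The wiring of a ring with nodes `ZMod n`, arranged cyclically, where the ports of each node are
assigned arbitrarily: Port 1 of `v` leads to `v + 1` and Port 0 to `v - 1` if `flip v = false`, and
conversely if `flip v = true`. The port at the other end of the edge at port `e.2` of node `e.1`. -/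
def peer {n : ℕ} (flip : ZMod n → Bool) (e : ZMod n × Bool) : ZMod n × Bool :=
  if e.2 = flip e.1 then (e.1 - 1, !flip (e.1 - 1)) else (e.1 + 1, flip (e.1 + 1))

/-- A global configuration: the nodes' states, and for each port of each node the number of pulses
sent through that port that have not been received yet. -/
structure Config (n : ℕ) where
  node : ZMod n → NodeState
  transit : ZMod n × Bool → ℕ

/-- Initially every node sends one pulse through each of its ports. -/
def Config.init {n : ℕ} (rule : VirtualIdRule) (ω : ZMod n → NodeSource) : Config n where
  node := fun v => NodeState.init rule (ω v)
  transit := fun _ => 1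

/-- A pulse sent through port `e` is received at the other end `peer flip e` by the node there,
which reacts: it counts the pulse, possibly forwards it through its opposite port, recomputes its
output and possibly resamples its ID. -/
def Config.deliver {n : ℕ} (flip : ZMod n → Bool) (ω : ZMod n → NodeSource) (C : Config n)
    (e : ZMod n × Bool) : Config n :=
  let u := (peer flip e).1
  let q := (peer flip e).2
  let s := (C.node u).count q
  let t := Function.update C.transit e (C.transit e - 1)
  { node := Function.update C.node u (s.computeOutput.resample (ω u).2)
    transit := if s.forwards q then Function.update t (u, !q) (t (u, !q) + 1) else t }

/-- One asynchronous step: some pulse in transit, chosen arbitrarily, is received. -/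
def Step {n : ℕ} (flip : ZMod n → Bool) (ω : ZMod n → NodeSource) (C C' : Config n) : Prop :=
  ∃ e, 0 < C.transit e ∧ C' = C.deliver flip ω e

/-- Quiescence: no pulse is in transit. -/
def Config.Quiescent {n : ℕ} (C : Config n) : Prop :=
  ∀ e, C.transit e = 0

/-- An execution, under an arbitrary scheduler: pulses are received one after the other as long as
some pulse is in transit; afterwards nothing changes. -/
structure IsExecution {n : ℕ} (rule : VirtualIdRule) (flip : ZMod n → Bool)
    (ω : ZMod n → NodeSource) (E : ℕ → Config n) : Prop where
  start : E 0 = Config.init rule ω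
  next : ∀ t, Step flip ω (E t) (E (t + 1)) ∨ ((E t).Quiescent ∧ E (t + 1) = E t)

/-- For the outcome `ω` of the randomness, every execution reaches quiescence, and when it does, the
IDs held by the nodes are pairwise distinct. -/
def DistinctIdsAtQuiescence {n : ℕ} (rule : VirtualIdRule) (flip : ZMod n → Bool)
    (ω : ZMod n → NodeSource) : Prop :=
  ∀ E : ℕ → Config n, IsExecution rule flip ω E →
    (∃ t, (E t).Quiescent) ∧
      ∀ t, (E t).Quiescent → Function.Injective fun v => ((E t).node v).id

end AnonRing

/-!
A pulse travelling in a given direction is absorbed exactly when a node's count in that direction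
reaches the virtual ID of the node for that direction. Pulses are conserved otherwise, so every
count stays below the largest such virtual ID, whence quiescence, and at quiescence equals it. Thus
all nodes end up with the same pair of counts. Let `m` be the smaller one. The nodes whose initial
ID is at least `m` keep it, whereas all others drew their last sample from `{1, ..., m - 1}` upon
receiving the last of equally many pulses. The range of that coin depends on the initial IDs only,
which are independent of the coins.

Fix a cutoff `T` of order `n ^ (2 + c / 2)`. An initial ID exceeds `T` with probability of order
`T ^ (-1 / (c + 2))`, which is much larger than `1 / n`, so some initial ID does with high
probability, and then `T < m`. By the birthday bound, the initial IDs above `T` are pairwise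
distinct, and so are uniform samples from a range of size at least `T`, both up to probability
`n ^ 2 / T`.
-/

namespace AnonRing

open MeasureTheory ProbabilityTheory

/-! ### Collisions and product measures -/

section Probability

open scoped ENNReal

variable {Ω β : Type*} [MeasurableSpace Ω] {μ : Measure Ω}

theorem measure_mem_and_eq_le [Countable β] [MeasurableSpace β] [MeasurableSingletonClass β]
    [IsProbabilityMeasure μ] {X Y : Ω → β} (hXY : IndepFun X Y μ) (hY : Measurable Y) {s : Set β}
    {δ : ℝ≥0∞} (hs : ∀ x ∈ s, μ (X ⁻¹' {x}) ≤ δ) : μ {ω | X ω ∈ s ∧ X ω = Y ω} ≤ δ := by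
  calc μ {ω | X ω ∈ s ∧ X ω = Y ω}
      = μ (⋃ x ∈ s, X ⁻¹' {x} ∩ Y ⁻¹' {x}) := by
        congr 1
        ext ω
        simp [eq_comm]
    _ ≤ ∑' x : s, μ (X ⁻¹' {x.1} ∩ Y ⁻¹' {x.1}) := measure_biUnion_le μ s.to_countable _
    _ ≤ ∑' x : s, δ * μ (Y ⁻¹' {x.1}) := by
        refine ENNReal.tsum_le_tsum fun x => ?_
        rw [hXY.measure_inter_preimage_eq_mul _ _ (measurableSet_singleton _)
          (measurableSet_singleton _)]
        gcongr
        exact hs x x.2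
    _ ≤ δ * 1 := by
        rw [ENNReal.tsum_mul_left, tsum_measure_preimage_singleton s.to_countable fun x _ =>
          hY (measurableSet_singleton x)]
        gcongr
        exact prob_le_one
    _ = δ := mul_one δ

/-- The birthday bound. -/
theorem measure_exists_ne_and_mem_and_eq_le {ι : Type*} [Fintype ι] [Countable β]
    [MeasurableSpace β] [MeasurableSingletonClass β] {X : ι → Ω → β} (hX : iIndepFun X μ)
    (hmeas : ∀ i, Measurable (X i)) {s : Set β} {δ : ℝ≥0∞}
    (hs : ∀ i, ∀ x ∈ s, μ (X i ⁻¹' {x}) ≤ δ) :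
    μ {ω | ∃ i j, i ≠ j ∧ X i ω ∈ s ∧ X i ω = X j ω} ≤ Fintype.card ι ^ 2 * δ := by
  have := hX.isProbabilityMeasure
  have hpair (x : ι × ι) : μ {ω | x.1 ≠ x.2 ∧ X x.1 ω ∈ s ∧ X x.1 ω = X x.2 ω} ≤ δ := by
    by_cases hx : x.1 = x.2
    · simp [hx]
    · simpa [hx] using measure_mem_and_eq_le (hX.indepFun hx) (hmeas x.2) (hs x.1)
  calc μ {ω | ∃ i j, i ≠ j ∧ X i ω ∈ s ∧ X i ω = X j ω}
      = μ (⋃ x : ι × ι, {ω | x.1 ≠ x.2 ∧ X x.1 ω ∈ s ∧ X x.1 ω = X x.2 ω}) := by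
        congr 1
        ext ω
        simp
    _ ≤ ∑ x : ι × ι, μ {ω | x.1 ≠ x.2 ∧ X x.1 ω ∈ s ∧ X x.1 ω = X x.2 ω} :=
        measure_iUnion_fintype_le μ _
    _ ≤ ∑ _x : ι × ι, δ := Finset.sum_le_sum fun x _ => hpair x
    _ = Fintype.card ι ^ 2 * δ := by
        simp only [Finset.sum_const, Finset.card_univ, Fintype.card_prod, nsmul_eq_mul,
          Nat.cast_mul, sq]

theorem measure_pi_forall_notMem_le {ι : Type*} [Fintype ι] [IsProbabilityMeasure μ] {s : Set Ω}
    (hs : MeasurableSet s) {q : ℝ} (hq : ENNReal.ofReal q ≤ μ s) :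
    Measure.pi (fun _ : ι => μ) {ω | ∀ i, ω i ∉ s} ≤
      ENNReal.ofReal (Real.exp (-(Fintype.card ι * q))) := by
  have hcompl : μ sᶜ ≤ ENNReal.ofReal (Real.exp (-q)) := by
    rw [prob_compl_eq_one_sub hs, tsub_le_iff_right]
    calc (1 : ℝ≥0∞) = ENNReal.ofReal 1 := ENNReal.ofReal_one.symm
      _ ≤ ENNReal.ofReal (Real.exp (-q) + q) :=
        ENNReal.ofReal_le_ofReal (by linarith [Real.add_one_le_exp (-q)])
      _ ≤ ENNReal.ofReal (Real.exp (-q)) + ENNReal.ofReal q := ENNReal.ofReal_add_le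
      _ ≤ ENNReal.ofReal (Real.exp (-q)) + μ s := by gcongr
  have hpi : {ω : ι → Ω | ∀ i, ω i ∉ s} = Set.univ.pi fun _ => sᶜ := by
    ext ω
    simp
  calc Measure.pi (fun _ : ι => μ) {ω | ∀ i, ω i ∉ s} = μ sᶜ ^ Fintype.card ι := by
        rw [hpi, Measure.pi_pi, Finset.prod_const, Finset.card_univ]
    _ ≤ ENNReal.ofReal (Real.exp (-q)) ^ Fintype.card ι := by gcongr
    _ = ENNReal.ofReal (Real.exp (-(Fintype.card ι * q))) := by
        rw [← ENNReal.ofReal_pow (Real.exp_pos _).le, ← Real.exp_nat_mul, mul_neg]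

theorem measure_prod_le_of_forall_section_le {Ω' : Type*} [MeasurableSpace Ω']
    [IsProbabilityMeasure μ] {ν : Measure Ω'} [SFinite ν] {s : Set (Ω × Ω')}
    (hs : MeasurableSet s) {δ : ℝ≥0∞} (h : ∀ ω, ν (Prod.mk ω ⁻¹' s) ≤ δ) : μ.prod ν s ≤ δ := by
  calc μ.prod ν s = ∫⁻ ω, ν (Prod.mk ω ⁻¹' s) ∂μ := Measure.prod_apply hs
    _ ≤ ∫⁻ _, δ ∂μ := lintegral_mono h
    _ = δ := by simp

end Probability

/-! ### The law of the sampled IDs -/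

theorem bitsToId_eq {k : ℕ} (b : Fin k → Bool) :
    bitsToId b = 1 + (finFunctionFinEquiv fun i => finTwoEquiv.symm (b i) : Fin (2 ^ k)) := by
  rw [finFunctionFinEquiv_apply, bitsToId]
  congr 1
  refine Finset.sum_congr rfl fun i _ => ?_
  cases b i <;> simp [finTwoEquiv]

theorem bitsToId_injective {k : ℕ} : Function.Injective (bitsToId : (Fin k → Bool) → ℕ) := by
  intro a b h
  rw [bitsToId_eq, bitsToId_eq] at h
  have hab := finFunctionFinEquiv.injective (Fin.ext (Nat.add_left_cancel h))
  exact funext fun i => finTwoEquiv.symm.injective (congrFun hab i)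

theorem bitsToId_mem_Icc {k : ℕ} (b : Fin k → Bool) : bitsToId b ∈ Finset.Icc 1 (2 ^ k) := by
  rw [bitsToId_eq, Finset.mem_Icc]
  omega

theorem image_bitsToId (k : ℕ) :
    Finset.univ.image (bitsToId : (Fin k → Bool) → ℕ) = Finset.Icc 1 (2 ^ k) := by
  refine Finset.eq_of_subset_of_card_le (Finset.image_subset_iff.2 fun b _ => bitsToId_mem_Icc b) ?_
  rw [Finset.card_image_of_injective _ bitsToId_injective]
  simp

theorem uniformUpTo_apply (m x : ℕ) :
    uniformUpTo m x = if x ∈ Finset.Icc 1 (max 1 m) then ((max 1 m : ℕ) : ENNReal)⁻¹ else 0 := by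
  refine (PMF.uniformOfFinset_apply _ x).trans ?_
  rw [Nat.card_Icc, add_tsub_cancel_right]
  congr

theorem uniformUpTo_apply_le {m : ℕ} (hm : 1 ≤ m) (x : ℕ) :
    uniformUpTo m x ≤ (m : ENNReal)⁻¹ := by
  rw [uniformUpTo_apply, max_eq_right hm]
  split_ifs <;> simp

theorem map_bitsToId_uniformOfFintype (k : ℕ) :
    (PMF.uniformOfFintype (Fin k → Bool)).map bitsToId = uniformUpTo (2 ^ k) := by
  ext x
  rw [uniformUpTo_apply, max_eq_right Nat.one_le_two_pow, ← image_bitsToId, PMF.map_apply]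
  split_ifs with hx
  · obtain ⟨b, -, rfl⟩ := Finset.mem_image.1 hx
    simp [bitsToId_injective.eq_iff, PMF.uniformOfFintype_apply]
  · refine ENNReal.tsum_eq_zero.2 fun b => if_neg fun h => hx ?_
    exact h ▸ Finset.mem_image_of_mem _ (Finset.mem_univ b)

theorem uniformUpTo_apply_le_inv (m x : ℕ) : uniformUpTo m x ≤ (x : ENNReal)⁻¹ := by
  rw [uniformUpTo_apply]
  split_ifs with hx
  · exact ENNReal.inv_le_inv.2 (Nat.cast_le.2 (Finset.mem_Icc.1 hx).2)
  · exact zero_le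

theorem uniformUpTo_two_pow_Ioi (K : ℕ) :
    (uniformUpTo (2 ^ (K + 1))).toMeasure (Set.Ioi (2 ^ K)) = 2⁻¹ := by
  have hfilter : (Finset.Icc 1 (max 1 (2 ^ (K + 1)))).filter (· ∈ Set.Ioi (2 ^ K)) =
      Finset.Ioc (2 ^ K) (2 ^ (K + 1)) := by
    ext x
    rw [max_eq_right Nat.one_le_two_pow]
    simp only [Finset.mem_filter, Finset.mem_Icc, Set.mem_Ioi, Finset.mem_Ioc]
    omega
  classical
  calc (uniformUpTo (2 ^ (K + 1))).toMeasure (Set.Ioi (2 ^ K))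
      = (2 ^ K : ℕ) / (2 ^ K * 2 : ℕ) := by
        refine (PMF.toMeasure_uniformOfFinset_apply _ _ measurableSet_Ioi).trans ?_
        rw [Finset.filter_congr_decidable, hfilter, Nat.card_Icc, Nat.card_Ioc,
          max_eq_right Nat.one_le_two_pow, add_tsub_cancel_right, pow_succ, mul_two,
          Nat.add_sub_cancel]
    _ = 2⁻¹ := by
        rw [Nat.cast_mul, div_eq_mul_inv, ENNReal.mul_inv (by simp) (by simp), ← mul_assoc,
          ENNReal.mul_inv_cancel (by simp) (by simp), one_mul, Nat.cast_ofNat]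

theorem sampledId_eq_bind (c : ℝ) (hc : 0 < c) : sampledId c hc =
    (geometricMeasure (geoParam c hc)).toPMF.bind fun k => uniformUpTo (2 ^ (k + 1)) := by
  simp only [sampledId, map_bitsToId_uniformOfFintype]

theorem sampledId_apply_le (c : ℝ) (hc : 0 < c) (x : ℕ) :
    sampledId c hc x ≤ (x : ENNReal)⁻¹ := by
  rw [sampledId_eq_bind, PMF.bind_apply]
  calc ∑' k, (geometricMeasure (geoParam c hc)).toPMF k * uniformUpTo (2 ^ (k + 1)) x
      ≤ ∑' k, (geometricMeasure (geoParam c hc)).toPMF k * (x : ENNReal)⁻¹ := by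
        gcongr
        exact uniformUpTo_apply_le_inv _ x
    _ = (x : ENNReal)⁻¹ := by rw [ENNReal.tsum_mul_right, PMF.tsum_coe, one_mul]

theorem sampledId_zero (c : ℝ) (hc : 0 < c) : sampledId c hc 0 = 0 := by
  simp [sampledId_eq_bind, PMF.bind_apply, uniformUpTo_apply]

/-- The paper's `p`: the number of bits of a sampled ID exceeds `k` with probability
`geoRatio c ^ k`. -/
noncomputable def geoRatio (c : ℝ) : ℝ :=
  (2 : ℝ) ^ (-1 / (c + 2))

theorem geoRatio_pos (c : ℝ) : 0 < geoRatio c :=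
  Real.rpow_pos_of_pos two_pos _

theorem geoRatio_lt_one {c : ℝ} (hc : 0 < c) : geoRatio c < 1 :=
  Real.rpow_lt_one_of_one_lt_of_neg one_lt_two
    (div_neg_of_neg_of_pos (by norm_num) (by linarith))

theorem geometricMeasure_geoParam_singleton {c : ℝ} (hc : 0 < c) (k : ℕ) :
    geometricMeasure (geoParam c hc) {k} =
      ENNReal.ofReal (geoRatio c ^ k * (1 - geoRatio c)) := by
  have hval : (geoParam c hc : ℝ) = 1 - geoRatio c := rfl
  have hne : geoParam c hc ≠ 0 := by
    refine fun h => (sub_pos.2 (geoRatio_lt_one hc)).ne' ?_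
    rw [← hval, h, Set.Icc.coe_zero]
  rw [geometricMeasure_singleton hne, hval, sub_sub_cancel]

theorem ofReal_le_sampledId_Ioi {c : ℝ} (hc : 0 < c) (K : ℕ) :
    ENNReal.ofReal (geoRatio c ^ K * (1 - geoRatio c) / 2) ≤
      (sampledId c hc).toMeasure (Set.Ioi (2 ^ K)) := by
  rw [sampledId_eq_bind, PMF.toMeasure_bind_apply _ _ _ measurableSet_Ioi]
  refine le_trans (le_of_eq ?_) (ENNReal.le_tsum K)
  rw [Measure.toPMF_apply, geometricMeasure_geoParam_singleton hc, uniformUpTo_two_pow_Ioi,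
    ENNReal.ofReal_div_of_pos two_pos, div_eq_mul_inv, ENNReal.ofReal_ofNat]

/-! ### Pulses on the ring -/

section Ring

variable {n : ℕ}

/-- The neighbour of `v` in direction `d`. A direction of travel around the ring is a Boolean:
`false` leads from `v` to `v + 1`, and `true` from `v` to `v - 1`. -/
def nextNode (d : Bool) (v : ZMod n) : ZMod n :=
  v + if d then -1 else 1

/-- The port at which `v` receives the pulses travelling in direction `d`. -/
def inPort (flip : ZMod n → Bool) (d : Bool) (v : ZMod n) : Bool :=
  xor (flip v) d

/-- The directed edge from `v` to its neighbour in direction `d`, encoded as in `Config.transit` by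
the port of `v` at which it starts. -/
def outEdge (flip : ZMod n → Bool) (d : Bool) (v : ZMod n) : ZMod n × Bool :=
  (v, !inPort flip d v)

theorem nextNode_inj {d : Bool} {v w : ZMod n} : nextNode d v = nextNode d w ↔ v = w := by
  simp only [nextNode, add_left_inj]

theorem exists_iterate_nextNode_eq [NeZero n] (d : Bool) (v w : ZMod n) :
    ∃ k, (nextNode d)^[k] v = w := by
  unfold nextNode
  cases d
  · exact ⟨(w - v).val, by simp [add_right_iterate_apply]⟩
  · exact ⟨(v - w).val, by simp [add_right_iterate_apply]⟩

theorem eq_of_forall_le_nextNode [NeZero n] {α : Type*} [PartialOrder α] {d : Bool}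
    {f : ZMod n → α} (hf : ∀ v, f v ≤ f (nextNode d v)) (v w : ZMod n) : f v = f w := by
  have hle (v w) : f v ≤ f w := by
    obtain ⟨k, rfl⟩ := exists_iterate_nextNode_eq d v w
    have hmono : Monotone fun k => f ((nextNode d)^[k] v) :=
      monotone_nat_of_le_succ fun k => by
        simpa only [Function.iterate_succ_apply'] using hf _
    exact hmono k.zero_le
  exact le_antisymm (hle v w) (hle w v)

theorem inPort_inj {flip : ZMod n → Bool} {d d' : Bool} {v : ZMod n} :
    inPort flip d v = inPort flip d' v ↔ d = d' := by
  simp [inPort]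

theorem outEdge_inj {flip : ZMod n → Bool} {d d' : Bool} {v w : ZMod n} :
    outEdge flip d v = outEdge flip d' w ↔ d = d' ∧ v = w := by
  simp only [outEdge, Prod.mk.injEq, Bool.not_inj_iff]
  constructor
  · rintro ⟨rfl, h⟩
    exact ⟨inPort_inj.1 h, rfl⟩
  · rintro ⟨rfl, rfl⟩
    exact ⟨rfl, rfl⟩

theorem exists_outEdge_eq (flip : ZMod n → Bool) (e : ZMod n × Bool) :
    ∃ d v, outEdge flip d v = e :=
  ⟨!(xor (flip e.1) e.2), e.1, by simp [outEdge, inPort]⟩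

theorem peer_outEdge (flip : ZMod n → Bool) (d : Bool) (v : ZMod n) :
    peer flip (outEdge flip d v) = (nextNode d v, inPort flip d (nextNode d v)) := by
  cases d <;> cases h : flip v <;> simp [peer, outEdge, inPort, nextNode, sub_eq_add_neg, h]

/-- The number of pulses travelling in direction `d` that node `v` has received. -/
def Config.received (C : Config n) (flip : ZMod n → Bool) (d : Bool) (v : ZMod n) : ℕ :=
  (C.node v).recv (inPort flip d v)

/-- The number of pulses in transit from `v` to its neighbour in direction `d`. -/
def Config.inTransit (C : Config n) (flip : ZMod n → Bool) (d : Bool) (v : ZMod n) : ℕ :=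
  C.transit (outEdge flip d v)

/-- The initially sampled IDs. -/
def initialId (ω : ZMod n → NodeSource) (v : ZMod n) : ℕ :=
  (ω v).1

/-- The count at which `v` absorbs a pulse travelling in direction `d`, if the initial IDs are
`a`: the virtual ID belonging to the port through which `v` would forward the pulse. -/
def threshold (rule : VirtualIdRule) (flip : ZMod n → Bool) (a : ZMod n → ℕ) (d : Bool)
    (v : ZMod n) : ℕ :=
  rule.virtualId (a v) (!inPort flip d v)

/-- The largest threshold in direction `d`, if the initial IDs are `a`. -/
def maxThreshold [NeZero n] (rule : VirtualIdRule) (flip : ZMod n → Bool) (a : ZMod n → ℕ)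
    (d : Bool) : ℕ :=
  Finset.univ.sup (threshold rule flip a d)

theorem VirtualIdRule.le_virtualId (rule : VirtualIdRule) {x : ℕ} (hx : 1 ≤ x) (i : Bool) :
    x ≤ rule.virtualId x i := by
  cases rule <;> simp only [virtualId] <;> omega

theorem threshold_le_maxThreshold [NeZero n] (rule : VirtualIdRule) (flip : ZMod n → Bool)
    (a : ZMod n → ℕ) (d : Bool) (v : ZMod n) :
    threshold rule flip a d v ≤ maxThreshold rule flip a d :=
  Finset.le_sup (f := threshold rule flip a d) (Finset.mem_univ v)

/-! ### The reaction of a node -/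

/-- The reaction of a node to a pulse received at port `q`, as in `Config.deliver`. -/
def NodeState.receive (coin : ℕ × ℕ → ℕ) (s : NodeState) (q : Bool) : NodeState :=
  (s.count q).computeOutput.resample coin

theorem NodeState.computeOutput_id (s : NodeState) : s.computeOutput.id = s.id := by
  unfold computeOutput
  split_ifs <;> rfl

theorem NodeState.computeOutput_virt (s : NodeState) : s.computeOutput.virt = s.virt := by
  unfold computeOutput
  split_ifs <;> rfl

theorem NodeState.computeOutput_recv (s : NodeState) : s.computeOutput.recv = s.recv := by
  unfold computeOutput
  split_ifs <;> rfl

theorem NodeState.receive_virt (coin : ℕ × ℕ → ℕ) (s : NodeState) (q : Bool) :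
    (s.receive coin q).virt = s.virt := by
  simp only [receive, resample, apply_ite NodeState.virt, ite_self, computeOutput_virt, count]

theorem NodeState.receive_recv (coin : ℕ × ℕ → ℕ) (s : NodeState) (q : Bool) :
    (s.receive coin q).recv = Function.update s.recv q (s.recv q + 1) := by
  simp only [receive, resample, apply_ite NodeState.recv, ite_self, computeOutput_recv, count]

theorem NodeState.receive_id (coin : ℕ × ℕ → ℕ) (s : NodeState) (q : Bool) :
    (s.receive coin q).id =
      let r := (s.receive coin q).recv
      if s.id < min (r false) (r true) then
        coin (r false + r true, min (r false) (r true) - 1)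
      else s.id := by
  simp only [receive_recv]
  simp only [receive, resample, apply_ite NodeState.id, computeOutput_id, computeOutput_recv, count]

/-- A possible outcome of a node's randomness: the initial ID is positive, and every coin lies in
the range from which it is drawn. -/
def NodeSource.Regular (src : NodeSource) : Prop :=
  1 ≤ src.1 ∧ ∀ j m, src.2 (j, m) ∈ Finset.Icc 1 (max 1 m)

/-- The ID held by a node with randomness `src` that has received `r p` pulses at each port `p`. -/
def idAfter (src : NodeSource) (r : Bool → ℕ) : ℕ :=
  if src.1 < min (r false) (r true) then
    src.2 (r false + r true, min (r false) (r true) - 1)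
  else src.1

/-- A resampled ID lies strictly below the counts, so an ID is resampled at every pulse received
from the first resampling on. -/
theorem idAfter_lt_iff {src : NodeSource} (hsrc : src.Regular) {r : Bool → ℕ} {m : ℕ}
    (hm : min (r false) (r true) ≤ m) : idAfter src r < m ↔ src.1 < m := by
  have hcoin := hsrc.2 (r false + r true) (min (r false) (r true) - 1)
  have hpos := hsrc.1
  rw [Finset.mem_Icc] at hcoin
  unfold idAfter
  split_ifs <;> omega

theorem NodeState.receive_id_eq_idAfter {src : NodeSource} (hsrc : src.Regular) {s : NodeState}
    (hs : s.id = idAfter src s.recv) (q : Bool) :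
    (s.receive src.2 q).id = idAfter src (s.receive src.2 q).recv := by
  have hrecv : s.recv ≤ (s.receive src.2 q).recv := by
    rw [receive_recv, le_update_self_iff]
    exact Nat.le_succ _
  have hmin := min_le_min (hrecv false) (hrecv true)
  rw [receive_id, hs]
  simp only [idAfter_lt_iff hsrc hmin]
  conv_rhs => rw [idAfter]
  refine ite_congr rfl (fun _ => rfl) fun hlt => if_neg fun h => hlt (h.trans_le hmin)

/-! ### Invariants of an execution -/

section Deliver

variable {rule : VirtualIdRule} {flip : ZMod n → Bool} {ω : ZMod n → NodeSource}

theorem Config.node_deliver (C : Config n) (d : Bool) (v : ZMod n) :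
    (C.deliver flip ω (outEdge flip d v)).node =
      Function.update C.node (nextNode d v) ((C.node (nextNode d v)).receive
        (ω (nextNode d v)).2 (inPort flip d (nextNode d v))) := by
  simp only [deliver, peer_outEdge, NodeState.receive]

theorem Config.received_deliver (C : Config n) (d₀ d : Bool) (v₀ v : ZMod n) :
    (C.deliver flip ω (outEdge flip d₀ v₀)).received flip d v =
      C.received flip d v + if d = d₀ ∧ v = nextNode d₀ v₀ then 1 else 0 := by
  simp only [received, node_deliver]
  obtain rfl | hv := eq_or_ne v (nextNode d₀ v₀)
  · simp only [Function.update_self, NodeState.receive_recv, Function.update_apply, inPort_inj,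
      and_true]
    split_ifs with hd
    · rw [hd]
    · rfl
  · simp only [Function.update_of_ne hv, hv, and_false, if_false, add_zero]

theorem Config.inTransit_deliver {C : Config n}
    (hvirt : ∀ v, (C.node v).virt = rule.virtualId (initialId ω v)) {d₀ : Bool} {v₀ : ZMod n}
    (h : 0 < C.inTransit flip d₀ v₀) (d : Bool) (v : ZMod n) :
    (C.deliver flip ω (outEdge flip d₀ v₀)).inTransit flip d v +
        (if d = d₀ ∧ v = v₀ then 1 else 0) =
      C.inTransit flip d v + if (d = d₀ ∧ v = nextNode d₀ v₀) ∧
        C.received flip d v + 1 ≠ threshold rule flip (initialId ω) d v then 1 else 0 := by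
  have hforwards : ((C.node (nextNode d₀ v₀)).count (inPort flip d₀ (nextNode d₀ v₀))).forwards
      (inPort flip d₀ (nextNode d₀ v₀)) ↔ C.received flip d₀ (nextNode d₀ v₀) + 1 ≠
        threshold rule flip (initialId ω) d₀ (nextNode d₀ v₀) := by
    simp only [NodeState.forwards, NodeState.count, hvirt, threshold, received,
      Function.update_self]
  have hout : (nextNode d₀ v₀, !inPort flip d₀ (nextNode d₀ v₀)) =
    outEdge flip d₀ (nextNode d₀ v₀) := rfl
  simp only [inTransit, deliver, peer_outEdge, hforwards, hout] at h ⊢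
  simp only [apply_ite (fun t : ZMod n × Bool → ℕ => t (outEdge flip d v)),
    Function.update_apply, outEdge_inj]
  grind

theorem Config.forall_node_deliver (C : Config n) (P : ZMod n → NodeState → Prop)
    (hC : ∀ v, P v (C.node v))
    (hreceive : ∀ v q, P v ((C.node v).receive (ω v).2 q)) (e : ZMod n × Bool) (v : ZMod n) :
    P v ((C.deliver flip ω e).node v) := by
  obtain ⟨d₀, v₀, rfl⟩ := exists_outEdge_eq flip e
  rw [node_deliver]
  obtain rfl | hv := eq_or_ne v (nextNode d₀ v₀)
  · rw [Function.update_self]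
    exact hreceive _ _
  · rw [Function.update_of_ne hv]
    exact hC v

end Deliver

variable [NeZero n] {rule : VirtualIdRule} {flip : ZMod n → Bool} {ω : ZMod n → NodeSource}

/-- The properties of a configuration that hold throughout an execution. -/
structure Config.Invariant (rule : VirtualIdRule) (flip : ZMod n → Bool)
    (ω : ZMod n → NodeSource) (C : Config n) : Prop where
  virt : ∀ v, (C.node v).virt = rule.virtualId (initialId ω v)
  /-- Every node starts with one pulse of its own, and forwards all the pulses that it receives
  except the one that brings the count to its threshold. -/
  conservation : ∀ d v, C.inTransit flip d v + C.received flip d (nextNode d v) +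
      (if threshold rule flip (initialId ω) d v ≤ C.received flip d v then 1 else 0) =
    C.received flip d v + 1
  received_le : ∀ d v, C.received flip d v ≤ maxThreshold rule flip (initialId ω) d
  id : ∀ v, (C.node v).id = idAfter (ω v) (C.node v).recv

theorem Config.invariant_init (hω : ∀ v, (ω v).Regular) :
    (Config.init rule ω).Invariant rule flip ω where
  virt _ := rfl
  conservation d v := by
    have hpos : 1 ≤ threshold rule flip (initialId ω) d v :=
      (hω v).1.trans (rule.le_virtualId (hω v).1 _)
    have hzero : (Config.init rule ω).received flip d v = 0 := rfl
    rw [hzero, if_neg (by omega)]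
    rfl
  received_le _ _ := Nat.zero_le _
  id _ := rfl

namespace Config.Invariant

theorem conservation_deliver {C : Config n} (hC : C.Invariant rule flip ω) {d₀ : Bool}
    {v₀ : ZMod n} (h : 0 < C.inTransit flip d₀ v₀) (d : Bool) (v : ZMod n) :
    let C' := C.deliver flip ω (outEdge flip d₀ v₀)
    C'.inTransit flip d v + C'.received flip d (nextNode d v) +
      (if threshold rule flip (initialId ω) d v ≤ C'.received flip d v then 1 else 0) =
        C'.received flip d v + 1 := by
  have htransit := Config.inTransit_deliver (ω := ω) hC.virt h d v
  have hC := hC.conservation d v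
  simp only [Config.received_deliver]
  obtain rfl | hd := eq_or_ne d d₀
  · simp only [true_and, nextNode_inj] at htransit ⊢
    split_ifs at htransit hC ⊢ <;> grind
  · simp only [hd, false_and, if_false, add_zero] at htransit ⊢
    rw [htransit, hC]

theorem received_deliver_le {C : Config n} (hC : C.Invariant rule flip ω) {d₀ : Bool}
    {v₀ : ZMod n} (h : 0 < C.inTransit flip d₀ v₀) (d : Bool) (v : ZMod n) :
    (C.deliver flip ω (outEdge flip d₀ v₀)).received flip d v ≤
      maxThreshold rule flip (initialId ω) d := by
  rw [Config.received_deliver]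
  split_ifs with hv
  · obtain ⟨rfl, rfl⟩ := hv
    have hconservation := hC.conservation d v₀
    have hreceived := hC.received_le d v₀
    have hthreshold := threshold_le_maxThreshold rule flip (initialId ω) d v₀
    split_ifs at hconservation <;> omega
  · exact hC.received_le d v

theorem deliver {C : Config n} (hC : C.Invariant rule flip ω) (hω : ∀ v, (ω v).Regular)
    {e : ZMod n × Bool} (he : 0 < C.transit e) : (C.deliver flip ω e).Invariant rule flip ω := by
  obtain ⟨d₀, v₀, rfl⟩ := exists_outEdge_eq flip e
  exact
    { virt := C.forall_node_deliver (fun v s => s.virt = rule.virtualId (initialId ω v)) hC.virt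
        (fun v q => by rw [NodeState.receive_virt, hC.virt]) _
      conservation := hC.conservation_deliver he
      received_le := hC.received_deliver_le he
      id := C.forall_node_deliver (fun v s => s.id = idAfter (ω v) s.recv) hC.id
        (fun v q => NodeState.receive_id_eq_idAfter (hω v) (hC.id v) q) _ }

theorem received_eq {C : Config n} (hC : C.Invariant rule flip ω) (hq : C.Quiescent) (d : Bool)
    (v : ZMod n) : C.received flip d v = maxThreshold rule flip (initialId ω) d := by
  have hconservation (v) : C.received flip d (nextNode d v) +
      (if threshold rule flip (initialId ω) d v ≤ C.received flip d v then 1 else 0) =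
        C.received flip d v + 1 := by
    have htransit : C.inTransit flip d v = 0 := hq _
    simpa only [htransit, zero_add] using hC.conservation d v
  have hconst : ∀ v w, C.received flip d v = C.received flip d w :=
    eq_of_forall_le_nextNode (d := d) fun v => by
      have h := hconservation v
      split_ifs at h <;> omega
  refine le_antisymm (hC.received_le d v) (Finset.sup_le fun w _ => ?_)
  have h := hconservation w
  rw [hconst (nextNode d w) w] at h
  rw [hconst v w]
  split_ifs at h <;> omega

end Config.Invariant

namespace IsExecution

theorem invariant {E : ℕ → Config n} (hE : IsExecution rule flip ω E)
    (hω : ∀ v, (ω v).Regular) (t : ℕ) : (E t).Invariant rule flip ω := by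
  induction t with
  | zero => exact hE.start ▸ Config.invariant_init hω
  | succ t ih =>
    rcases hE.next t with ⟨e, he, h⟩ | ⟨-, h⟩
    · exact h ▸ ih.deliver hω he
    · exact h ▸ ih

theorem exists_quiescent {E : ℕ → Config n} (hE : IsExecution rule flip ω E)
    (hω : ∀ v, (ω v).Regular) : ∃ t, (E t).Quiescent := by
  by_contra! hactive
  have hreceived (t) : t ≤ ∑ x : Bool × ZMod n, (E t).received flip x.1 x.2 := by
    induction t with
    | zero => exact Nat.zero_le _
    | succ t ih =>
      obtain ⟨e, -, hstep⟩ := (hE.next t).resolve_right fun h => hactive t h.1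
      obtain ⟨d₀, v₀, rfl⟩ := exists_outEdge_eq flip e
      simp only [hstep, Config.received_deliver, ← Prod.mk.injEq, Finset.sum_add_distrib,
        Finset.sum_ite_eq', Finset.mem_univ, if_true]
      exact Nat.succ_le_succ ih
  have hbound (t) : t ≤ ∑ x : Bool × ZMod n, maxThreshold rule flip (initialId ω) x.1 :=
    (hreceived t).trans (Finset.sum_le_sum fun x _ => (hE.invariant hω t).received_le x.1 x.2)
  exact Nat.not_succ_le_self _ (hbound _)

end IsExecution

/-! ### The IDs at quiescence -/

/-- The smaller of the two counts that every node has at quiescence, if the initial IDs are `a`. -/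
def finalMin (rule : VirtualIdRule) (flip : ZMod n → Bool) (a : ZMod n → ℕ) : ℕ :=
  min (maxThreshold rule flip a false) (maxThreshold rule flip a true)

/-- The index of the coin that every node whose ID has been resampled drew last, at quiescence and
if the initial IDs are `a`: its first component is the total number of pulses that each node has
received. -/
def finalCoin (rule : VirtualIdRule) (flip : ZMod n → Bool) (a : ZMod n → ℕ) : ℕ × ℕ :=
  (maxThreshold rule flip a false + maxThreshold rule flip a true, finalMin rule flip a - 1)

theorem Config.Invariant.id_eq {C : Config n} (hC : C.Invariant rule flip ω) (hq : C.Quiescent)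
    (v : ZMod n) :
    (C.node v).id = if initialId ω v < finalMin rule flip (initialId ω) then
      (ω v).2 (finalCoin rule flip (initialId ω)) else initialId ω v := by
  have hfalse := hC.received_eq hq false v
  have htrue := hC.received_eq hq true v
  rw [hC.id v, idAfter, finalCoin, finalMin, ← hfalse, ← htrue]
  cases h : flip v <;> simp [Config.received, inPort, h, min_comm, add_comm, initialId]

theorem le_finalMin {a : ZMod n → ℕ} {v : ZMod n} (ha : 1 ≤ a v) : a v ≤ finalMin rule flip a :=
  have hle (d) : a v ≤ maxThreshold rule flip a d :=
    (rule.le_virtualId ha _).trans (threshold_le_maxThreshold rule flip a d v)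
  le_min (hle false) (hle true)

/-- A resampled ID is smaller than `finalMin`, and the initial IDs that are not resampled are at
least `finalMin`, hence above `T`. -/
theorem distinctIdsAtQuiescence_of_cutoff (hω : ∀ v, (ω v).Regular) {T : ℕ} (hT : 1 ≤ T)
    (hlarge : ∃ v, T < initialId ω v)
    (hid : ∀ u v, u ≠ v → T < initialId ω u → initialId ω u ≠ initialId ω v)
    (hcoin : T ≤ (finalCoin rule flip (initialId ω)).2 → ∀ u v, u ≠ v →
      (ω u).2 (finalCoin rule flip (initialId ω)) ≠ (ω v).2 (finalCoin rule flip (initialId ω))) :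
    DistinctIdsAtQuiescence rule flip ω := by
  obtain ⟨w, hw⟩ := hlarge
  have hcutoff : T < finalMin rule flip (initialId ω) := hw.trans_le (le_finalMin (hω w).1)
  have hcoin_lt (v) : (ω v).2 (finalCoin rule flip (initialId ω)) <
      finalMin rule flip (initialId ω) := by
    have h := Finset.mem_Icc.1 ((hω v).2 (finalCoin rule flip (initialId ω)).1
      (finalCoin rule flip (initialId ω)).2)
    simp only [finalCoin] at h ⊢
    omega
  refine fun E hE => ⟨hE.exists_quiescent hω, fun t ht u v huv => ?_⟩
  by_contra hne
  simp only [(hE.invariant hω t).id_eq ht] at huv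
  split_ifs at huv with hu hv hv
  · exact hcoin (Nat.le_sub_one_of_lt hcutoff) u v hne huv
  · exact hv (huv ▸ hcoin_lt u)
  · exact hu (huv ▸ hcoin_lt v)
  · exact hid u v hne (hcutoff.trans_le (not_lt.1 hu)) huv

end Ring
/-! ### The failure probability -/

section Network

variable (c : ℝ) (hc : 0 < c) (n : ℕ) [NeZero n]

instance : IsProbabilityMeasure (nodeSourceLaw c hc) := by
  unfold nodeSourceLaw
  infer_instance

instance : IsProbabilityMeasure (networkLaw c hc n) := by
  unfold networkLaw
  infer_instance

theorem measurePreserving_initialId (v : ZMod n) :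
    MeasurePreserving (fun ω => initialId ω v) (networkLaw c hc n) (sampledId c hc).toMeasure :=
  measurePreserving_fst.comp (measurePreserving_eval (fun _ => nodeSourceLaw c hc) v)

theorem measurePreserving_coin (v : ZMod n) (i : ℕ × ℕ) :
    MeasurePreserving (fun ω => (ω v).2 i) (networkLaw c hc n) (uniformUpTo i.2).toMeasure :=
  ((measurePreserving_eval_infinitePi (fun i : ℕ × ℕ => (uniformUpTo i.2).toMeasure) i).comp
    measurePreserving_snd).comp (measurePreserving_eval (fun _ => nodeSourceLaw c hc) v)

theorem ae_regular : ∀ᵐ ω ∂networkLaw c hc n, ∀ v, (ω v).Regular := by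
  have hid (v) : ∀ᵐ ω ∂networkLaw c hc n, 1 ≤ initialId ω v := by
    refine (measurePreserving_initialId c hc n v).quasiMeasurePreserving.ae
      (p := fun x => 1 ≤ x) (ae_iff_of_countable.2 fun x hx => ?_)
    rw [PMF.toMeasure_apply_singleton _ _ (measurableSet_singleton x)] at hx
    exact Nat.one_le_iff_ne_zero.2 fun h => hx (h ▸ sampledId_zero c hc)
  have hcoin (v) (i : ℕ × ℕ) :
      ∀ᵐ ω ∂networkLaw c hc n, (ω v).2 i ∈ Finset.Icc 1 (max 1 i.2) := by
    refine (measurePreserving_coin c hc n v i).quasiMeasurePreserving.ae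
      (p := fun x => x ∈ Finset.Icc 1 (max 1 i.2)) (ae_iff_of_countable.2 fun x hx => ?_)
    rw [PMF.toMeasure_apply_singleton _ _ (measurableSet_singleton x), uniformUpTo_apply] at hx
    exact of_not_not fun h => hx (if_neg h)
  filter_upwards [ae_all_iff.2 hid, ae_all_iff.2 fun v => ae_all_iff.2 (hcoin v)] with ω hid hcoin
  exact fun v => ⟨hid v, fun j m => hcoin v (j, m)⟩

theorem networkLaw_forall_initialId_le (K : ℕ) :
    networkLaw c hc n {ω | ∀ v, initialId ω v ≤ 2 ^ K} ≤
      ENNReal.ofReal (Real.exp (-(n * (geoRatio c ^ K * (1 - geoRatio c) / 2)))) := by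
  have hlarge : ENNReal.ofReal (geoRatio c ^ K * (1 - geoRatio c) / 2) ≤
      nodeSourceLaw c hc (Prod.fst ⁻¹' Set.Ioi (2 ^ K)) := by
    rw [nodeSourceLaw, measurePreserving_fst.measure_preimage measurableSet_Ioi.nullMeasurableSet]
    exact ofReal_le_sampledId_Ioi hc K
  have h := measure_pi_forall_notMem_le (ι := ZMod n) (measurable_fst measurableSet_Ioi) hlarge
  simp only [Set.mem_preimage, Set.mem_Ioi, not_lt, ZMod.card] at h
  exact h

theorem networkLaw_initialId_collision_le (T : ℕ) :
    networkLaw c hc n {ω | ∃ u v, u ≠ v ∧ T < initialId ω u ∧ initialId ω u = initialId ω v} ≤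
      n ^ 2 * (T : ENNReal)⁻¹ := by
  have hindep : iIndepFun (fun v ω => initialId ω v) (networkLaw c hc n) :=
    iIndepFun_pi (X := fun _ => Prod.fst) fun _ => measurable_fst.aemeasurable
  have h := measure_exists_ne_and_mem_and_eq_le (s := Set.Ioi T) (δ := (T : ENNReal)⁻¹) hindep
    (fun v => (measurePreserving_initialId c hc n v).measurable) fun v x hx => by
      have hsingleton := measurableSet_singleton x
      rw [(measurePreserving_initialId c hc n v).measure_preimage hsingleton.nullMeasurableSet,
        PMF.toMeasure_apply_singleton _ _ hsingleton]
      exact (sampledId_apply_le c hc x).trans (ENNReal.inv_le_inv.2 (Nat.cast_le.2 hx.le))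
  rwa [ZMod.card] at h

/-- The law of all the coins. -/
noncomputable def coinsLaw : Measure (ZMod n → ℕ × ℕ → ℕ) :=
  Measure.pi fun _ => Measure.infinitePi fun i : ℕ × ℕ => (uniformUpTo i.2).toMeasure

instance : IsProbabilityMeasure (coinsLaw n) := by
  unfold coinsLaw
  infer_instance

theorem coinsLaw_collision_le {T : ℕ} (hT : 1 ≤ T) {i : ℕ × ℕ} (hi : T ≤ i.2) :
    coinsLaw n {f | ∃ u v, u ≠ v ∧ f u i = f v i} ≤ n ^ 2 * (T : ENNReal)⁻¹ := by
  have hindep : iIndepFun (fun v f => f v i) (coinsLaw n) :=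
    iIndepFun_pi (X := fun (_ : ZMod n) (g : ℕ × ℕ → ℕ) => g i)
      (μ := fun _ => Measure.infinitePi fun i : ℕ × ℕ => (uniformUpTo i.2).toMeasure)
      fun _ => (measurable_pi_apply i).aemeasurable
  have hlaw (v) : MeasurePreserving (fun f => f v i) (coinsLaw n) (uniformUpTo i.2).toMeasure :=
    (measurePreserving_eval_infinitePi (fun i : ℕ × ℕ => (uniformUpTo i.2).toMeasure) i).comp
      (measurePreserving_eval _ v)
  have h := measure_exists_ne_and_mem_and_eq_le (s := Set.univ) (δ := (T : ENNReal)⁻¹) hindep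
    (fun v => (hlaw v).measurable) fun v x _ => by
      have hsingleton := measurableSet_singleton x
      rw [(hlaw v).measure_preimage hsingleton.nullMeasurableSet,
        PMF.toMeasure_apply_singleton _ _ hsingleton]
      exact (uniformUpTo_apply_le (hT.trans hi) x).trans (ENNReal.inv_le_inv.2 (Nat.cast_le.2 hi))
  simpa only [Set.mem_univ, true_and, ZMod.card] using h

theorem networkLaw_coin_collision_le {T : ℕ} (hT : 1 ≤ T) (i : (ZMod n → ℕ) → ℕ × ℕ) :
    networkLaw c hc n {ω | T ≤ (i (initialId ω)).2 ∧
      ∃ u v, u ≠ v ∧ (ω u).2 (i (initialId ω)) = (ω v).2 (i (initialId ω))} ≤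
        n ^ 2 * (T : ENNReal)⁻¹ := by
  let s : Set ((ZMod n → ℕ) × (ZMod n → ℕ × ℕ → ℕ)) :=
    {x | T ≤ (i x.1).2 ∧ ∃ u v, u ≠ v ∧ x.2 u (i x.1) = x.2 v (i x.1)}
  have hs : MeasurableSet s :=
    measurableSet_setOfPred.2 (measurable_from_prod_countable_right fun a => by measurability)
  have hsection (a) : coinsLaw n (Prod.mk a ⁻¹' s) ≤ n ^ 2 * (T : ENNReal)⁻¹ := by
    by_cases ha : T ≤ (i a).2
    · simpa [s, ha] using coinsLaw_collision_le n hT ha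
    · simp [s, ha]
  have hsplit := measurePreserving_arrowProdEquivProdArrow ℕ (ℕ × ℕ → ℕ) (ZMod n)
    (fun _ => (sampledId c hc).toMeasure)
    (fun _ => Measure.infinitePi fun i : ℕ × ℕ => (uniformUpTo i.2).toMeasure)
  exact (hsplit.measure_preimage hs.nullMeasurableSet).trans_le
    (measure_prod_le_of_forall_section_le hs hsection)

theorem networkLaw_not_distinctIdsAtQuiescence_le_of_cutoff (rule : VirtualIdRule)
    (flip : ZMod n → Bool) {T : ℕ} (hT : 1 ≤ T) :
    networkLaw c hc n {ω | ¬ DistinctIdsAtQuiescence rule flip ω} ≤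
      networkLaw c hc n {ω | ∀ v, initialId ω v ≤ T} +
        (n ^ 2 * (T : ENNReal)⁻¹ + n ^ 2 * (T : ENNReal)⁻¹) := by
  set small := {ω : ZMod n → NodeSource | ∀ v, initialId ω v ≤ T}
  set idCollision := {ω : ZMod n → NodeSource |
    ∃ u v, u ≠ v ∧ T < initialId ω u ∧ initialId ω u = initialId ω v}
  set coinCollision := {ω : ZMod n → NodeSource |
    T ≤ (finalCoin rule flip (initialId ω)).2 ∧ ∃ u v, u ≠ v ∧
      (ω u).2 (finalCoin rule flip (initialId ω)) = (ω v).2 (finalCoin rule flip (initialId ω))}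
  calc networkLaw c hc n {ω | ¬ DistinctIdsAtQuiescence rule flip ω}
      ≤ networkLaw c hc n (small ∪ (idCollision ∪ coinCollision)) := by
        refine measure_mono_ae ?_
        filter_upwards [ae_regular c hc n] with ω hω hbad
        by_contra hgood
        obtain ⟨hlarge, hid, hcoin⟩ : ω ∉ small ∧ ω ∉ idCollision ∧ ω ∉ coinCollision := by
          rwa [← not_or, ← not_or]
        refine hbad (distinctIdsAtQuiescence_of_cutoff hω hT ?_ ?_ ?_)
        · by_contra! hle
          exact hlarge hle
        · exact fun u v hne hu heq => hid ⟨u, v, hne, hu, heq⟩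
        · exact fun hle u v hne heq => hcoin ⟨hle, u, v, hne, heq⟩
    _ ≤ networkLaw c hc n small + (networkLaw c hc n idCollision +
          networkLaw c hc n coinCollision) :=
        (measure_union_le _ _).trans (by gcongr; exact measure_union_le _ _)
    _ ≤ networkLaw c hc n small + (n ^ 2 * (T : ENNReal)⁻¹ + n ^ 2 * (T : ENNReal)⁻¹) := by
        gcongr
        · exact networkLaw_initialId_collision_le c hc n T
        · exact networkLaw_coin_collision_le c hc n hT (finalCoin rule flip)

theorem networkLaw_not_distinctIdsAtQuiescence_le (rule : VirtualIdRule) (flip : ZMod n → Bool)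
    (K : ℕ) :
    networkLaw c hc n {ω | ¬ DistinctIdsAtQuiescence rule flip ω} ≤
      ENNReal.ofReal (Real.exp (-(n * (geoRatio c ^ K * (1 - geoRatio c) / 2))) +
        2 * ((n : ℝ) ^ 2 / 2 ^ K)) := by
  have hcast : (n : ENNReal) ^ 2 * ((2 ^ K : ℕ) : ENNReal)⁻¹ =
      ENNReal.ofReal ((n : ℝ) ^ 2 / 2 ^ K) := by
    rw [ENNReal.ofReal_div_of_pos (by positivity), ENNReal.ofReal_pow n.cast_nonneg,
      ENNReal.ofReal_pow two_pos.le, ENNReal.ofReal_natCast, ENNReal.ofReal_ofNat, div_eq_mul_inv,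
      Nat.cast_pow, Nat.cast_ofNat]
  rw [two_mul, ENNReal.ofReal_add (by positivity) (by positivity),
    ENNReal.ofReal_add (by positivity) (by positivity), ← hcast]
  refine (networkLaw_not_distinctIdsAtQuiescence_le_of_cutoff c hc n rule flip
    (Nat.one_le_two_pow (n := K))).trans ?_
  gcongr
  exact networkLaw_forall_initialId_le c hc n K

end Network

/-! ### The choice of the cutoff -/

section Cutoff

open Filter

theorem eventually_exp_neg_mul_rpow_le {a γ : ℝ} (ha : 0 < a) (hγ : 0 < γ) (s : ℝ) :
    ∀ᶠ x : ℝ in atTop, Real.exp (-a * x ^ γ) ≤ x ^ s := by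
  have hlittle := (isLittleO_exp_neg_mul_rpow_atTop ha (s / γ)).comp_tendsto (tendsto_rpow_atTop hγ)
  filter_upwards [hlittle.bound one_pos, eventually_ge_atTop 0] with x hx hx0
  simpa only [Function.comp_apply, Real.norm_eq_abs, one_mul, Real.abs_exp,
    ← Real.rpow_mul hx0, mul_div_cancel₀ _ hγ.ne', abs_of_nonneg (Real.rpow_nonneg hx0 s)] using hx

theorem sq_div_two_pow_le {x c : ℝ} (hx : 0 < x) {K : ℕ} (hK : x ^ (2 + c / 2) ≤ 2 ^ K) :
    x ^ 2 / 2 ^ K ≤ x ^ (-(c / 2)) := by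
  rw [div_le_iff₀ (by positivity)]
  calc x ^ 2 = x ^ (-(c / 2)) * x ^ (2 + c / 2) := by
        rw [← Real.rpow_add hx, ← Real.rpow_natCast]
        congr 1
        push_cast
        ring
    _ ≤ x ^ (-(c / 2)) * 2 ^ K := by gcongr

theorem geoRatio_pow (c : ℝ) (K : ℕ) : geoRatio c ^ K = ((2 : ℝ) ^ K) ^ (-1 / (c + 2)) := by
  rw [geoRatio, ← Real.rpow_mul_natCast two_pos.le, mul_comm, Real.rpow_natCast_mul two_pos.le]

theorem geoRatio_mul_rpow_le {x c : ℝ} (hx : 0 < x) (hc : 0 < c) {K : ℕ}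
    (hK : (2 : ℝ) ^ K ≤ 2 * x ^ (2 + c / 2)) :
    geoRatio c * x ^ (c / 2 / (c + 2)) ≤ x * geoRatio c ^ K := by
  have hexponent : -1 / (c + 2) ≤ 0 := div_nonpos_of_nonpos_of_nonneg (by norm_num) (by linarith)
  have hsplit : c / 2 / (c + 2) = 1 + (2 + c / 2) * (-1 / (c + 2)) := by
    field_simp
    ring
  calc geoRatio c * x ^ (c / 2 / (c + 2))
      = x * (2 * x ^ (2 + c / 2)) ^ (-1 / (c + 2)) := by
        rw [hsplit, Real.rpow_add hx, Real.rpow_one, Real.mul_rpow two_pos.le (by positivity),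
          ← Real.rpow_mul hx.le, ← geoRatio, mul_left_comm]
    _ ≤ x * geoRatio c ^ K := by
        rw [geoRatio_pow]
        gcongr ?_ * ?_
        exact Real.rpow_le_rpow_of_nonpos (by positivity) hK hexponent

theorem exists_le_two_pow_le {y : ℝ} (hy : 1 ≤ y) : ∃ K : ℕ, y ≤ 2 ^ K ∧ (2 : ℝ) ^ K ≤ 2 * y := by
  obtain ⟨K, hK, hK'⟩ := exists_nat_pow_near hy one_lt_two
  exact ⟨K + 1, hK'.le, by rw [pow_succ']; gcongr⟩

/-- The cutoff `2 ^ K` lies between `n ^ (2 + c / 2)` and twice that. -/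
theorem exists_forall_exists_failure_bound_le {c : ℝ} (hc : 0 < c) :
    ∃ n₀ : ℕ, ∀ n : ℕ, n₀ ≤ n → ∃ K : ℕ,
      Real.exp (-(n * (geoRatio c ^ K * (1 - geoRatio c) / 2))) + 2 * ((n : ℝ) ^ 2 / 2 ^ K) ≤
        (n : ℝ) ^ (-(1 / 4 * c)) := by
  have hone_sub : 0 < 1 - geoRatio c := sub_pos.2 (geoRatio_lt_one hc)
  have hrate : 0 < geoRatio c * (1 - geoRatio c) / 2 := by have := geoRatio_pos c; positivity
  have hexp := eventually_exp_neg_mul_rpow_le hrate (γ := c / 2 / (c + 2)) (by positivity)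
    (-(c / 2))
  have hthree := (tendsto_rpow_atTop (y := c / 4) (by positivity)).eventually_ge_atTop 3
  obtain ⟨n₀, hn₀⟩ := eventually_atTop.1 (tendsto_natCast_atTop_atTop.eventually
    (hexp.and (hthree.and (eventually_ge_atTop (1 : ℝ)))))
  refine ⟨n₀, fun n hn => ?_⟩
  obtain ⟨hexp, hthree, hone⟩ := hn₀ n hn
  have hpos : (0 : ℝ) < n := one_pos.trans_le hone
  obtain ⟨K, hle, hge⟩ := exists_le_two_pow_le
    (Real.one_le_rpow hone (show 0 ≤ 2 + c / 2 by positivity))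
  refine ⟨K, ?_⟩
  have hsmall : Real.exp (-(n * (geoRatio c ^ K * (1 - geoRatio c) / 2))) ≤
      (n : ℝ) ^ (-(c / 2)) := by
    refine le_trans (Real.exp_le_exp.2 ?_) hexp
    have h := mul_le_mul_of_nonneg_right (geoRatio_mul_rpow_le hpos hc hge) hone_sub.le
    linarith
  calc Real.exp (-(n * (geoRatio c ^ K * (1 - geoRatio c) / 2))) + 2 * ((n : ℝ) ^ 2 / 2 ^ K)
      ≤ 3 * (n : ℝ) ^ (-(c / 2)) := by linarith [sq_div_two_pow_le hpos hle]
    _ ≤ (n : ℝ) ^ (c / 4) * (n : ℝ) ^ (-(c / 2)) := by gcongr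
    _ = (n : ℝ) ^ (-(1 / 4 * c)) := by
        rw [← Real.rpow_add hpos]
        congr 1
        ring

end Cutoff

end AnonRing

/-- With high probability, i.e. except with probability `n ^ (-Ω(c))`, all nodes hold distinct IDs
at quiescence, for every assignment of the ports and whatever the scheduler does. -/
theorem mainTheorem6 :
    ∃ κ : ℝ, 0 < κ ∧ ∀ (c : ℝ) (hc : 0 < c), ∃ n₀ : ℕ, ∀ (n : ℕ) [NeZero n], n₀ ≤ n →
      ∀ (rule : AnonRing.VirtualIdRule) (flip : ZMod n → Bool),
        AnonRing.networkLaw c hc n {ω | ¬ AnonRing.DistinctIdsAtQuiescence rule flip ω} ≤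
          ENNReal.ofReal ((n : ℝ) ^ (-(κ * c))) := by
  refine ⟨1 / 4, by norm_num, fun c hc => ?_⟩
  obtain ⟨n₀, hn₀⟩ := AnonRing.exists_forall_exists_failure_bound_le hc
  refine ⟨n₀, fun n _ hn rule flip => ?_⟩
  obtain ⟨K, hK⟩ := hn₀ n hn
  exact (AnonRing.networkLaw_not_distinctIdsAtQuiescence_le c hc n rule flip K).trans
    (ENNReal.ofReal_le_ofReal hK)
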